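/- **Conventions.** All simplicial complexes are finite abstract simplicial complexes; $V(K)$ is the vertex set of $K$ and $S_i(K)$ the set of its $i$-faces (faces with $i+1$ vertices). We write $F\in\partial\bar F$ if $F\subset\bar F$ are faces with $|\bar F|=|F|+1$. A weight on $K$ is a positive function $w_K$ on the faces of $K$. The real cochain group $C^i(K,\mathbb R)=\mathrm{Hom}(C_i(K,\mathbb R),\mathbb R)$ carries the inner product $\langle f,g\rangle=\sum_{F\in S_i(K)}w_K(F)f([F])g([F])$, where $[F]$ is $F$ with any chosen orientation. With $\delta_i:C^i(K,\mathbb R)\to C^{i+1}(K,\mathbb R)$ the coboundary map, $\mathcal L_i^{\mathrm{up}}(K)=\delta_i^*\delta_i$. An incidence-signed complex $(M,s)$ is a complex $M$ with a function $s(F,\bar F)\in\{-1,0,1\}$ on pairs of faces which is $\pm1$ if $F\in\partial\bar F$ and $0$ otherwise. Its coboundary map is $$(\delta_i^sf)([v_0,\dots,v_{i+1}])=\sum_{j=0}^{i+1}(-1)^j\,s\big(\{v_0,\dots,\widehat{v_j},\dots,v_{i+1}\},\{v_0,\dots,v_{i+1}\}\big)\,f([v_0,\dots,\widehat{v_j},\dots,v_{i+1}]),$$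 and $\mathcal L_i^{\mathrm{up}}(M,s)=(\delta_i^s)^*\delta_i^s$. $\operatorname{Spec}$ denotes the multiset of eigenvalues. A ($2$-fold, strong) covering $\phi:K\to M$ is a simplicial map such that $K$ is connected (its $1$-skeleton is a connected graph); for each nonempty face $G$ of $M$ the faces $F$ of $K$ with $\phi(F)=G$ are pairwise disjoint, are mapped bijectively onto $G$ by $\phi$, have union $\phi^{-1}(G)\subseteq V(K)$, and are exactly $2$ in number; and whenever $G\in\partial\bar G$ in $M$ and $\phi(F)=G$, there is a face $\bar F$ of $K$ with $F\in\partial\bar F$ and $\phi(\bar F)=\bar G$. The $i$-th incidence graph $B_i(K)$ is the bipartite graph on $S_i(K)\cup S_{i+1}(K)$ in which $F$ and $\bar F$ are adjacent iff $F\in\partial\bar F$. A permutation assignment $\psi$ on $B_i(M)$ assigns to each arc $(u,v)$ of $B_i(M)$ an element $\psi(u,v)$ of the symmetric group $\mathbb S_2$ on $\{1,2\}$ with $\psi(v,u)=\psi(u,v)^{-1}$. The derived graph $B_i(M)^\psi$ has vertices $(u,a)$, $a\in\{1,2\}$, where $(u,a)$ and $(v,b)$ are adjacent iff $u,v$ are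 adjacent in $B_i(M)$ and $a=\psi(u,v)(b)$. **Theorem.** Let $\phi:K\to M$ be a $2$-fold covering, let $w_K,w_M$ be weights with $w_K(F)=w_M(\phi(F))$ for all faces $F$ of $K$, and let $i\ge0$. Then there is a permutation assignment $\psi$ on $B_i(M)$ with values in $\mathbb S_2$ for which there is a graph isomorphism $\eta:B_i(M)^\psi\to B_i(K)$ with $\phi(\eta(G,a))=G$ for all vertices $(G,a)$. For every such $\psi$ and every incidence-signed complex $(M,s)$ with $s(F,\bar F)=\operatorname{sgn}\psi(F,\bar F)$ for all $F\in S_i(M)$, $\bar F\in S_{i+1}(M)$ with $F\in\partial\bar F$ (such $s$ exist), one has, as a multiset union (multiplicities added), $$\operatorname{Spec}\mathcal L_i^{\mathrm{up}}(K)=\operatorname{Spec}\mathcal L_i^{\mathrm{up}}(M)\ \cup\ \operatorname{Spec}\mathcal L_i^{\mathrm{up}}(M,s).$$ -/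

import Mathlib

noncomputable section

/-- `F.Incident F'`, written `F ∈ ∂F'` in the usual notation: `F` arises from `F'` by deleting
exactly one vertex. -/
def Finset.Incident {V : Type*} (F F' : Finset V) : Prop :=
  F ⊆ F' ∧ F'.card = F.card + 1

namespace AbstractSimplicialComplex

variable {V W : Type*}

/-! ### Faces, ordered faces and real chains

Mathlib's `AbstractSimplicialComplex V` lists the nonempty faces only, and its vertex set is all of
`V`.  The empty simplex plays no role in the dimensions `i ≥ 0` considered here. -/

/-- The set `S_i(K)` of `i`-faces, that is, of faces with `i + 1` vertices. -/
def Face (K : AbstractSimplicialComplex V) (i : ℕ) : Type _ :=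
  {F : K // F.1.card = i + 1}

instance [Finite V] (K : AbstractSimplicialComplex V) (i : ℕ) : Finite (K.Face i) :=
  inferInstanceAs (Finite {F : K // F.1.card = i + 1})

instance [Finite V] (K : AbstractSimplicialComplex V) (i : ℕ) : Fintype (K.Face i) :=
  Fintype.ofFinite _

/-- An `i`-face together with an ordering `v₀, …, v_i` of its vertices. -/
def OrderedFace (K : AbstractSimplicialComplex V) (i : ℕ) : Type _ :=
  {t : Fin (i + 1) ↪ V // Finset.univ.map t ∈ K}

namespace OrderedFace

variable {K : AbstractSimplicialComplex V} {i : ℕ}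

instance [Finite V] : Finite (K.OrderedFace i) :=
  inferInstanceAs (Finite {t : Fin (i + 1) ↪ V // Finset.univ.map t ∈ K})

/-- The underlying face `{v₀, …, v_i}`. -/
def toFace (t : K.OrderedFace i) : K := ⟨Finset.univ.map t.1, t.2⟩

theorem map_perm (σ : Equiv.Perm (Fin (i + 1))) (t : Fin (i + 1) ↪ V) :
    Finset.univ.map (σ.toEmbedding.trans t) = Finset.univ.map t := by
  rw [← Finset.map_map]
  simp

/-- The reordering `(v_{σ 0}, …, v_{σ i})`. -/
def perm (t : K.OrderedFace i) (σ : Equiv.Perm (Fin (i + 1))) : K.OrderedFace i :=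
  ⟨σ.toEmbedding.trans t.1, by rw [map_perm]; exact t.2⟩

/-- The ordered face `(v₀, …, v̂_j, …, v_{i+1})` obtained by omitting `v_j`. -/
def erase (t : K.OrderedFace (i + 1)) (j : Fin (i + 2)) : K.OrderedFace i :=
  ⟨(Fin.succAboveEmb j).trans t.1, by
    refine (K.isRelLowerSet_faces t.2).2 ?_ (by simp)
    rw [← Finset.map_map]
    exact Finset.map_subset_map.2 (Finset.subset_univ _)⟩

theorem toFace_perm (t : K.OrderedFace i) (σ : Equiv.Perm (Fin (i + 1))) :
    (t.perm σ).toFace = t.toFace :=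
  Subtype.ext (map_perm σ t.1)

theorem exists_perm_of_toFace_eq {t t' : K.OrderedFace i} (h : t.toFace = t'.toFace) :
    ∃ σ, t' = t.perm σ := by
  have h' : ∀ x, ∃ y, t.1 y = t'.1 x := by
    intro x
    have hx : t'.1 x ∈ t.toFace.1 := by rw [h]; simp [toFace]
    simpa [toFace] using hx
  choose σ hσ using h'
  have hinj : Function.Injective σ := fun a b hab => t'.1.injective (by rw [← hσ, ← hσ, hab])
  refine ⟨Equiv.ofBijective σ (Finite.injective_iff_bijective.1 hinj), Subtype.ext ?_⟩
  ext x
  exact (hσ x).symm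

/-- Omitting the `j`-th vertex after a reordering `σ` amounts to omitting the `σ j`-th vertex and
reordering by some `τ` with `sgn σ · (-1)^{σ j} = (-1)^j · sgn τ`. -/
theorem exists_erase_perm (t : K.OrderedFace (i + 1)) (σ : Equiv.Perm (Fin (i + 2)))
    (j : Fin (i + 2)) :
    ∃ τ : Equiv.Perm (Fin (i + 1)), (t.perm σ).erase j = (t.erase (σ j)).perm τ ∧
      ((-1 : ℤ) ^ (j : ℕ)) * (Equiv.Perm.sign τ : ℤ) =
        (Equiv.Perm.sign σ : ℤ) * (-1) ^ (σ j : ℕ) := by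
  set ρ : Equiv.Perm (Fin (i + 2)) := (Fin.cycleRange (σ j)) * σ * (Fin.cycleRange j)⁻¹ with hρ
  have h0 : ρ 0 = 0 := by
    simp [hρ, Equiv.Perm.mul_apply, Equiv.Perm.inv_def, Fin.cycleRange_symm_zero,
      Fin.cycleRange_self]
  obtain ⟨⟨p, τ⟩, hτ⟩ := Equiv.Perm.decomposeFin.symm.surjective ρ
  have hp : p = 0 := by
    have := congrArg (fun e : Equiv.Perm (Fin (i + 2)) => e 0) hτ
    simpa [h0] using this
  subst hp
  refine ⟨τ, Subtype.ext ?_, ?_⟩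
  · ext x
    have hx : ρ x.succ = (τ x).succ := by
      rw [← hτ]; simp
    have hx' : σ (j.succAbove x) = (σ j).succAbove (τ x) := by
      rw [← Fin.cycleRange_symm_succ, ← Fin.cycleRange_symm_succ, ← hx]
      simp [hρ, Equiv.Perm.mul_apply, Equiv.Perm.inv_def]
    exact congrArg t.1 hx'
  · have hs : Equiv.Perm.sign ρ = Equiv.Perm.sign τ := by
      rw [← hτ]; simp
    rw [← hs, hρ]
    simp only [map_mul, map_inv, Fin.sign_cycleRange]
    rcases Nat.even_or_odd (j : ℕ) with hj | hj <;>
      rcases Nat.even_or_odd (σ j : ℕ) with hk | hk <;>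
      simp [hj.neg_one_pow, hk.neg_one_pow]

end OrderedFace

/-- The relations `[v_{σ 0}, …, v_{σ i}] = sgn σ · [v₀, …, v_i]` between ordered faces. -/
def orientationRelations (K : AbstractSimplicialComplex V) (i : ℕ) :
    Submodule ℝ (K.OrderedFace i →₀ ℝ) :=
  Submodule.span ℝ {x | ∃ (t : K.OrderedFace i) (σ : Equiv.Perm (Fin (i + 1))),
    x = Finsupp.single (t.perm σ) 1 - Finsupp.single t ((Equiv.Perm.sign σ : ℤ) : ℝ)}

/-- The chain group `C_i(K, ℝ)`: generated by the oriented `i`-faces, two opposite orientations of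
the same face being negatives of each other. -/
abbrev Chain (K : AbstractSimplicialComplex V) (i : ℕ) : Type _ :=
  (K.OrderedFace i →₀ ℝ) ⧸ K.orientationRelations i

/-- The oriented face `[v₀, …, v_i]` as a chain. -/
def OrderedFace.toChain {K : AbstractSimplicialComplex V} {i : ℕ} (t : K.OrderedFace i) :
    K.Chain i :=
  (K.orientationRelations i).mkQ (Finsupp.single t 1)

theorem OrderedFace.toChain_perm {K : AbstractSimplicialComplex V} {i : ℕ} (t : K.OrderedFace i)
    (σ : Equiv.Perm (Fin (i + 1))) :
    (t.perm σ).toChain = ((Equiv.Perm.sign σ : ℤ) : ℝ) • t.toChain := by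
  rw [toChain, toChain, ← map_smul, ← sub_eq_zero, ← map_sub]
  rw [Submodule.mkQ_apply, Submodule.Quotient.mk_eq_zero]
  exact Submodule.subset_span ⟨t, σ, by simp⟩

/-! ### Incidence-signed complexes and (signed) boundary maps -/

/-- The sign function of an incidence-signed complex `(K, s)`: `s (F, F')` is `1` or `-1` if
`F ∈ ∂F'`, and `0` otherwise. -/
structure IncidenceSign (K : AbstractSimplicialComplex V) where
  toFun : K → K → SignType
  ne_zero_iff : ∀ F F' : K, toFun F F' ≠ 0 ↔ F.1.Incident F'.1

open Classical in
/-- The sign function that is `1` on every incidence; it gives back the ordinary complex `K`. -/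
def IncidenceSign.one (K : AbstractSimplicialComplex V) : K.IncidenceSign where
  toFun F F' := if F.1.Incident F'.1 then 1 else 0
  ne_zero_iff F F' := by simp

/-- The signed boundary map `∂^s : C_{i+1}(K, ℝ) → C_i(K, ℝ)`,
`∂^s [v₀, …, v_{i+1}] = ∑ j, (-1)^j s(F_j, F) [v₀, …, v̂_j, …, v_{i+1}]`, where
`F = {v₀, …, v_{i+1}}` and `F_j = F \ {v_j}`. -/
def signedBoundary (K : AbstractSimplicialComplex V) (s : K.IncidenceSign) (i : ℕ) :
    K.Chain (i + 1) →ₗ[ℝ] K.Chain i :=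
  (K.orientationRelations (i + 1)).liftQ
    (Finsupp.linearCombination ℝ fun t : K.OrderedFace (i + 1) =>
      ∑ j : Fin (i + 2),
        ((-1 : ℝ) ^ (j : ℕ) * (s.toFun (t.erase j).toFace t.toFace : ℝ)) • (t.erase j).toChain)
    (by
      rw [orientationRelations, Submodule.span_le]
      rintro _ ⟨t, σ, rfl⟩
      simp only [SetLike.mem_coe, LinearMap.mem_ker, map_sub, Finsupp.linearCombination_single,
        one_smul, sub_eq_zero, Finset.smul_sum]
      rw [← Equiv.sum_comp σ (fun j : Fin (i + 2) => ((Equiv.Perm.sign σ : ℤ) : ℝ) •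
        ((-1 : ℝ) ^ (j : ℕ) * (s.toFun (t.erase j).toFace t.toFace : ℝ)) • (t.erase j).toChain)]
      refine Finset.sum_congr rfl fun j _ => ?_
      obtain ⟨τ, h, hs⟩ := t.exists_erase_perm σ j
      have hs' := congrArg (Int.cast : ℤ → ℝ) hs
      push_cast at hs'
      rw [h, OrderedFace.toFace_perm, OrderedFace.toFace_perm, OrderedFace.toChain_perm,
        smul_smul, smul_smul]
      congr 1
      linear_combination (s.toFun (t.erase (σ j)).toFace t.toFace : ℝ) * hs')

theorem signedBoundary_toChain (K : AbstractSimplicialComplex V) (s : K.IncidenceSign) (i : ℕ)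
    (t : K.OrderedFace (i + 1)) :
    K.signedBoundary s i t.toChain = ∑ j : Fin (i + 2),
      ((-1 : ℝ) ^ (j : ℕ) * (s.toFun (t.erase j).toFace t.toFace : ℝ)) •
        (t.erase j).toChain := by
  rw [signedBoundary, OrderedFace.toChain, Submodule.mkQ_apply, Submodule.liftQ_apply,
    Finsupp.linearCombination_single, one_smul]

/-- The ordinary boundary map, i.e. the one with `s = 1` on all incidences. -/
def boundary (K : AbstractSimplicialComplex V) (i : ℕ) : K.Chain (i + 1) →ₗ[ℝ] K.Chain i :=
  K.signedBoundary (IncidenceSign.one K) i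

theorem boundary_toChain (K : AbstractSimplicialComplex V) (i : ℕ) (t : K.OrderedFace (i + 1)) :
    K.boundary i t.toChain = ∑ j : Fin (i + 2), (-1 : ℝ) ^ (j : ℕ) • (t.erase j).toChain := by
  rw [boundary, signedBoundary_toChain]
  refine Finset.sum_congr rfl fun j _ => ?_
  have h : (t.erase j).toFace.1.Incident t.toFace.1 := by
    refine ⟨?_, by simp [OrderedFace.toFace]⟩
    simp only [OrderedFace.toFace, OrderedFace.erase]
    rw [← Finset.map_map]
    exact Finset.map_subset_map.2 (Finset.subset_univ _)
  simp [IncidenceSign.one, h]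

/-! ### Weights, cochains and the up Laplace operators -/

/-- A positive weight on the faces of `K`. -/
structure FaceWeight (K : AbstractSimplicialComplex V) where
  toFun : K → ℝ
  pos : ∀ F, 0 < toFun F

/-- The cochain group `C^i(K, ℝ) = Hom(C_i(K, ℝ), ℝ)`; the weight is recorded in the type because it
determines the inner product. -/
def Cochain (K : AbstractSimplicialComplex V) (_w : K.FaceWeight) (i : ℕ) : Type _ :=
  Module.Dual ℝ (K.Chain i)

/-- A choice of an orientation of every `i`-face. -/
def Face.orient {K : AbstractSimplicialComplex V} {i : ℕ} (F : K.Face i) : K.OrderedFace i :=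
  ⟨(F.1.1.equivFinOfCardEq F.2).symm.toEmbedding.trans (Function.Embedding.subtype _), by
    convert F.1.2 using 1
    ext x
    simp only [Finset.mem_map, Finset.mem_univ, true_and, Function.Embedding.trans_apply,
      Equiv.coe_toEmbedding, Function.Embedding.subtype_apply]
    exact ⟨by rintro ⟨a, rfl⟩; exact Subtype.prop _,
      fun hx => ⟨F.1.1.equivFinOfCardEq F.2 ⟨x, hx⟩, by simp⟩⟩⟩

theorem Face.toFace_orient {K : AbstractSimplicialComplex V} {i : ℕ} (F : K.Face i) :
    F.orient.toFace = F.1 := by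
  apply Subtype.ext
  ext x
  simp only [OrderedFace.toFace, Face.orient, Finset.mem_map, Finset.mem_univ, true_and,
    Function.Embedding.trans_apply, Equiv.coe_toEmbedding, Function.Embedding.subtype_apply]
  exact ⟨by rintro ⟨a, rfl⟩; exact Subtype.prop _,
    fun hx => ⟨F.1.1.equivFinOfCardEq F.2 ⟨x, hx⟩, by simp⟩⟩

namespace Cochain

variable {K : AbstractSimplicialComplex V} {w : K.FaceWeight} {i : ℕ}

instance : AddCommGroup (K.Cochain w i) := inferInstanceAs (AddCommGroup (Module.Dual ℝ (K.Chain i)))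

instance : Module ℝ (K.Cochain w i) := inferInstanceAs (Module ℝ (Module.Dual ℝ (K.Chain i)))

instance [Finite V] : FiniteDimensional ℝ (K.Cochain w i) :=
  inferInstanceAs (FiniteDimensional ℝ (Module.Dual ℝ (K.Chain i)))

/-- The value `f([v₀, …, v_i])`. -/
def eval (f : K.Cochain w i) (t : K.OrderedFace i) : ℝ :=
  (show Module.Dual ℝ (K.Chain i) from f) t.toChain

theorem eval_perm (f : K.Cochain w i) (t : K.OrderedFace i) (σ : Equiv.Perm (Fin (i + 1))) :
    f.eval (t.perm σ) = ((Equiv.Perm.sign σ : ℤ) : ℝ) * f.eval t := by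
  rw [eval, OrderedFace.toChain_perm, map_smul, smul_eq_mul, eval]

theorem ext_eval {f g : K.Cochain w i} (h : ∀ t, f.eval t = g.eval t) : f = g := by
  refine Submodule.linearMap_qext _ (Finsupp.lhom_ext' fun t => LinearMap.ext_ring ?_)
  exact h t

/-- The product `f([F]) g([F])` does not depend on the orientation of `F`. -/
theorem eval_mul_eval (f g : K.Cochain w i) {t t' : K.OrderedFace i} (h : t.toFace = t'.toFace) :
    f.eval t * g.eval t = f.eval t' * g.eval t' := by
  obtain ⟨σ, rfl⟩ := OrderedFace.exists_perm_of_toFace_eq h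
  rw [eval_perm, eval_perm]
  rcases Int.units_eq_one_or (Equiv.Perm.sign σ) with h | h <;> simp [h]

variable [Finite V]

/-- The weighted inner product `⟨f, g⟩ = ∑ F ∈ S_i(K), w(F) f([F]) g([F])`. -/
@[reducible]
def innerCore : InnerProductSpace.Core ℝ (K.Cochain w i) where
  inner f g := ∑ F : K.Face i, w.toFun F.1 * (f.eval F.orient * g.eval F.orient)
  conj_inner_symm f g := by simp [mul_comm]
  re_inner_nonneg f := by
    simp only [RCLike.re_to_real]
    exact Finset.sum_nonneg fun F _ => mul_nonneg (w.pos _).le (mul_self_nonneg _)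
  add_left f g h := by
    rw [← Finset.sum_add_distrib]
    refine Finset.sum_congr rfl fun F _ => ?_
    rw [show (f + g).eval F.orient = f.eval F.orient + g.eval F.orient from rfl]
    ring
  smul_left f g r := by
    rw [Finset.mul_sum]
    refine Finset.sum_congr rfl fun F _ => ?_
    rw [show (r • f).eval F.orient = r * f.eval F.orient from rfl]
    simp only [conj_trivial]
    ring
  definite f hf := by
    refine ext_eval fun t => ?_
    rw [Finset.sum_eq_zero_iff_of_nonneg
      (fun F _ => mul_nonneg (w.pos _).le (mul_self_nonneg _))] at hf
    have h := hf ⟨t.toFace, by simp [OrderedFace.toFace]⟩ (Finset.mem_univ _)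
    rw [mul_eq_zero, or_iff_right (w.pos _).ne',
      eval_mul_eval f f (t' := t) (Face.toFace_orient _)] at h
    exact mul_self_eq_zero.1 h

instance : NormedAddCommGroup (K.Cochain w i) := innerCore.toNormedAddCommGroup

instance : InnerProductSpace ℝ (K.Cochain w i) := InnerProductSpace.ofCore innerCore.toCore

theorem inner_eq (f g : K.Cochain w i) :
    inner ℝ f g = ∑ F : K.Face i, w.toFun F.1 * (f.eval F.orient * g.eval F.orient) := rfl

end Cochain

/-- The signed coboundary map `δ^s : C^i(K, ℝ) → C^{i+1}(K, ℝ)`, `δ^s f = f ∘ ∂^s`. -/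
def signedCoboundary [Finite V] (K : AbstractSimplicialComplex V) (w : K.FaceWeight)
    (s : K.IncidenceSign) (i : ℕ) : K.Cochain w i →ₗ[ℝ] K.Cochain w (i + 1) :=
  (K.signedBoundary s i).dualMap

/-- The coboundary map `δ : C^i(K, ℝ) → C^{i+1}(K, ℝ)`, `δ f = f ∘ ∂`. -/
def coboundary [Finite V] (K : AbstractSimplicialComplex V) (w : K.FaceWeight) (i : ℕ) :
    K.Cochain w i →ₗ[ℝ] K.Cochain w (i + 1) :=
  (K.boundary i).dualMap

theorem signedCoboundary_eval [Finite V] (K : AbstractSimplicialComplex V) (w : K.FaceWeight)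
    (s : K.IncidenceSign) (i : ℕ) (f : K.Cochain w i) (t : K.OrderedFace (i + 1)) :
    (K.signedCoboundary w s i f).eval t = ∑ j : Fin (i + 2),
      ((-1 : ℝ) ^ (j : ℕ) * (s.toFun (t.erase j).toFace t.toFace : ℝ)) * f.eval (t.erase j) := by
  let f' : Module.Dual ℝ (K.Chain i) := f
  change f' (K.signedBoundary s i t.toChain) = _
  rw [signedBoundary_toChain, map_sum]
  exact Finset.sum_congr rfl fun j _ => map_smul f' _ _

theorem coboundary_eval [Finite V] (K : AbstractSimplicialComplex V) (w : K.FaceWeight) (i : ℕ)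
    (f : K.Cochain w i) (t : K.OrderedFace (i + 1)) :
    (K.coboundary w i f).eval t =
      ∑ j : Fin (i + 2), (-1 : ℝ) ^ (j : ℕ) * f.eval (t.erase j) := by
  let f' : Module.Dual ℝ (K.Chain i) := f
  change f' (K.boundary i t.toChain) = _
  rw [boundary_toChain, map_sum]
  exact Finset.sum_congr rfl fun j _ => map_smul f' _ _

/-- The `i`-up Laplace operator `δ* δ` of the weighted complex `K`. -/
def upLaplacian [Finite V] (K : AbstractSimplicialComplex V) (w : K.FaceWeight) (i : ℕ) :
    K.Cochain w i →ₗ[ℝ] K.Cochain w i :=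
  LinearMap.adjoint (K.coboundary w i) ∘ₗ K.coboundary w i

/-- The `i`-up Laplace operator `(δ^s)* δ^s` of the weighted incidence-signed complex `(K, s)`. -/
def signedUpLaplacian [Finite V] (K : AbstractSimplicialComplex V) (w : K.FaceWeight)
    (s : K.IncidenceSign) (i : ℕ) : K.Cochain w i →ₗ[ℝ] K.Cochain w i :=
  LinearMap.adjoint (K.signedCoboundary w s i) ∘ₗ K.signedCoboundary w s i

/-! ### Simplicial maps and coverings -/

/-- The 1-skeleton of `K` as a graph. -/
def skeletonGraph (K : AbstractSimplicialComplex V) : SimpleGraph V where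
  Adj u v := u ≠ v ∧ ∃ F ∈ K, (F : Set V) = {u, v}
  symm := ⟨fun _ _ h => ⟨h.1.symm, by simpa only [Set.pair_comm] using h.2⟩⟩
  loopless := ⟨fun _ h => h.1 rfl⟩

/-- A simplicial map `K → M`: a map between the vertex sets sending faces to faces. -/
structure SimplicialMap [DecidableEq W] (K : AbstractSimplicialComplex V)
    (M : AbstractSimplicialComplex W) where
  toFun : V → W
  image_mem : ∀ F ∈ K, F.image toFun ∈ M

namespace SimplicialMap

variable [DecidableEq W] {K : AbstractSimplicialComplex V} {M : AbstractSimplicialComplex W}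

/-- The induced map on faces, `F ↦ φ(F)`. -/
def mapFace (φ : SimplicialMap K M) (F : K) : M := ⟨F.1.image φ.toFun, φ.image_mem F.1 F.2⟩

/-- `φ : K → M` is a covering map: `K` is connected, and for each face `G` of `M` the faces of `K`
lying over `G` are pairwise disjoint, are mapped bijectively onto `G`, and have union `φ⁻¹(G)`. -/
structure IsCovering (φ : SimplicialMap K M) : Prop where
  connected : K.skeletonGraph.Connected
  bijOn : ∀ (G : M) (F : K), φ.mapFace F = G → Set.BijOn φ.toFun F.1 G.1
  disjoint : ∀ (G : M) (F F' : K), φ.mapFace F = G → φ.mapFace F' = G → F ≠ F' → Disjoint F.1 F'.1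
  preimage_eq : ∀ G : M, φ.toFun ⁻¹' (G.1 : Set W) = ⋃ F ∈ {F : K | φ.mapFace F = G}, (F.1 : Set V)

/-- A strong covering: whenever `G ∈ ∂G'` in `M`, each face `F` over `G` lies in the boundary of a
face over `G'`. -/
structure IsStrongCovering (φ : SimplicialMap K M) : Prop extends φ.IsCovering where
  lift : ∀ G G' : M, G.1.Incident G'.1 → ∀ F : K, φ.mapFace F = G →
    ∃ F' : K, F.1.Incident F'.1 ∧ φ.mapFace F' = G'

/-- A `k`-fold covering: a strong covering of degree `k`, i.e. every (nonempty) face of `M` has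
exactly `k` faces of `K` above it. -/
structure IsFoldCovering (φ : SimplicialMap K M) (k : ℕ) : Prop extends φ.IsStrongCovering where
  card_fiber : ∀ G : M, Nat.card {F : K // φ.mapFace F = G} = k

end SimplicialMap

/-! ### Incidence graphs and their description by permutation voltages -/

/-- The vertex set `S_i(K) ∪ S_{i+1}(K)` of the `i`-th incidence graph. -/
abbrev IncidenceVertex (K : AbstractSimplicialComplex V) (i : ℕ) : Type _ :=
  {F : K // F.1.card = i + 1 ∨ F.1.card = i + 2}

/-- The `i`-th incidence graph `B_i(K)`: an `i`-face `F` is joined to an `(i+1)`-face `F'` if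
`F ∈ ∂F'`. -/
def incidenceGraph (K : AbstractSimplicialComplex V) (i : ℕ) :
    SimpleGraph (K.IncidenceVertex i) where
  Adj F F' := F.1.1.Incident F'.1.1 ∨ F'.1.1.Incident F.1.1
  symm := ⟨fun _ _ h => h.symm⟩
  loopless := ⟨fun F h => by rcases h with h | h <;> exact absurd h.2 (by omega)⟩

end AbstractSimplicialComplex

/-- A permutation assignment `ψ : E(G) → 𝕊_k` on the arcs of the symmetric digraph of `G`, with
`ψ(e⁻¹) = ψ(e)⁻¹`. -/
structure SimpleGraph.PermVoltage {α : Type*} (G : SimpleGraph α) (k : ℕ) where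
  toFun : G.Dart → Equiv.Perm (Fin k)
  map_symm : ∀ e : G.Dart, toFun e.symm = (toFun e)⁻¹

/-- The derived graph `G^ψ` on `V(G) × [k]`: `(u, a)` and `(v, b)` are adjacent if `u` and `v` are
and `a = ψ(u, v)(b)`. -/
def SimpleGraph.PermVoltage.derivedGraph {α : Type*} {G : SimpleGraph α} {k : ℕ}
    (ψ : G.PermVoltage k) : SimpleGraph (α × Fin k) where
  Adj p q := ∃ h : G.Adj p.1 q.1, p.2 = ψ.toFun ⟨(p.1, q.1), h⟩ q.2
  symm := ⟨by
    rintro p q ⟨h, hp⟩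
    refine ⟨h.symm, ?_⟩
    have := ψ.map_symm ⟨(p.1, q.1), h⟩
    rw [show (⟨(q.1, p.1), h.symm⟩ : G.Dart) = (⟨(p.1, q.1), h⟩ : G.Dart).symm from rfl, this, hp]
    simp⟩
  loopless := ⟨fun p ⟨h, _⟩ => G.loopless.irrefl p.1 h⟩

namespace AbstractSimplicialComplex

variable {V W : Type*} [DecidableEq W] {K : AbstractSimplicialComplex V}
  {M : AbstractSimplicialComplex W}

/-- `ψ` describes `φ` on the `i`-th incidence graphs: there is a graph isomorphism
`η : B_i(M)^ψ ≅ B_i(K)` over `B_i(M)`, i.e. with `φ(η(G, a)) = G`. -/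
def SimplicialMap.IsDerivedBy (φ : SimplicialMap K M) {i k : ℕ}
    (ψ : (M.incidenceGraph i).PermVoltage k) : Prop :=
  ∃ η : ψ.derivedGraph ≃g K.incidenceGraph i,
    ∀ (G : M.IncidenceVertex i) (a : Fin k), φ.mapFace (η (G, a)).1 = G.1

/-- `s(F, F') = sgn ψ(F, F')` for all `F ∈ S_i(M)`, `F' ∈ S_{i+1}(M)` with `F ∈ ∂F'`. -/
def IncidenceSign.IsSignOf {i k : ℕ} (s : M.IncidenceSign)
    (ψ : (M.incidenceGraph i).PermVoltage k) : Prop :=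
  ∀ e : (M.incidenceGraph i).Dart, e.fst.1.1.Incident e.snd.1.1 →
    (s.toFun e.fst.1 e.snd.1 : ℤ) = (Equiv.Perm.sign (ψ.toFun e) : ℤ)

end AbstractSimplicialComplex

/-- The spectrum of a real operator as a multiset: the complex eigenvalues, each repeated according
to its algebraic multiplicity. -/
def LinearMap.specMultiset {E : Type*} [AddCommGroup E] [Module ℝ E] [FiniteDimensional ℝ E]
    (T : E →ₗ[ℝ] E) : Multiset ℂ :=
  T.charpoly.aroots ℂ

end

/-! Number by 0 and 1 the two faces of `K` above each `i`- or `(i+1)`-face of `M`, and let `ε = ±1`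
be the resulting sheet sign. Pulling a cochain of `M` back along `φ` gives a cochain that agrees on
both sheets; multiplying the pullback by `ε` gives one that changes sign between them. Taking
half-sums and half-differences over the two sheets shows that every cochain of `K` is a sum of one
of each kind (`exists_eq_add_twistedPullback`). Since the weights are constant along fibres, both
pullbacks scale the inner product by 2, and their ranges are orthogonal (`inner_twistedPullback`).

The plain pullback carries `δ` of `M` to `δ` of `K`. The twisted one carries `δ^s` to `δ` because
`ε(F) = ε(F') s(φ F, φ F')` whenever `F ∈ ∂F'` (`coboundary_twistedPullback`). This relation is the
adjacency rule `a = ψ(b)` of the derived graph, read through the isomorphism of the symmetric group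
on two letters with `{±1}`. Orthogonality then transfers the intertwining to `δ* δ`, so the operator
on `K` is conjugate to the direct sum of the two operators on `M`, and characteristic polynomials
multiply (`charpoly_adjoint_comp_self_of_splitting`).

For the existence of `ψ`, adjacent faces `G`, `G'` of `B_i(M)` have fibres matched one to one by
incidence in `K` (`existsUnique_adj`). Arbitrary numberings of the fibres turn this matching into a
permutation. -/

noncomputable section

/-! ### Operators of the form `d* d` on a two-part orthogonal decomposition -/

section Splitting

variable {E E₁ E₂ F F₁ F₂ : Type*}
  [NormedAddCommGroup E] [InnerProductSpace ℝ E] [FiniteDimensional ℝ E]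
  [NormedAddCommGroup E₁] [InnerProductSpace ℝ E₁] [FiniteDimensional ℝ E₁]
  [NormedAddCommGroup E₂] [InnerProductSpace ℝ E₂]
  [NormedAddCommGroup F] [InnerProductSpace ℝ F] [FiniteDimensional ℝ F]
  [NormedAddCommGroup F₁] [InnerProductSpace ℝ F₁] [FiniteDimensional ℝ F₁]
  [NormedAddCommGroup F₂] [InnerProductSpace ℝ F₂]

open LinearMap in
/-- Let `A`, `A'` scale inner products by `c`, let `A ⊥ B`, `A' ⊥ B'`, and let the ranges of `A`
and `B` span. If `A`, `A'` intertwine `d₁` with `d`, and `B`, `B'` intertwine `d₂` with `d`, then `A`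
intertwines `d₁* d₁` with `d* d`. -/
theorem LinearMap.adjoint_comp_self_intertwine {c : ℝ} {A : E₁ →ₗ[ℝ] E} {B : E₂ →ₗ[ℝ] E}
    {A' : F₁ →ₗ[ℝ] F} {B' : F₂ →ₗ[ℝ] F} {d : E →ₗ[ℝ] F} {d₁ : E₁ →ₗ[ℝ] F₁} {d₂ : E₂ →ₗ[ℝ] F₂}
    (hA : ∀ x y, inner ℝ (A x) (A y) = c * inner ℝ x y) (hAB : ∀ x y, inner ℝ (A x) (B y) = 0)
    (hA' : ∀ x y, inner ℝ (A' x) (A' y) = c * inner ℝ x y)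
    (hAB' : ∀ x y, inner ℝ (A' x) (B' y) = 0)
    (hdA : ∀ x, d (A x) = A' (d₁ x)) (hdB : ∀ x, d (B x) = B' (d₂ x))
    (hsurj : ∀ z, ∃ x y, z = A x + B y) (x : E₁) :
    (adjoint d ∘ₗ d) (A x) = A ((adjoint d₁ ∘ₗ d₁) x) := by
  -- Test against `A u + B v`: the `B` part contributes zero on both sides, and the `A` parts agree
  -- with the same factor `c`.
  refine ext_inner_right ℝ fun z => ?_
  obtain ⟨u, v, rfl⟩ := hsurj z
  simp only [comp_apply, adjoint_inner_left, hdA, hdB, inner_add_right, hA', hAB', hA, hAB]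

variable [FiniteDimensional ℝ E₂] [FiniteDimensional ℝ F₂]

-- The map `(x, y) ↦ A x + B y` conjugates the direct sum of `d₁* d₁` and `d₂* d₂` to `d* d`.
-- Orthogonality together with `c ≠ 0` makes it injective. The ranges of `A'` and `B'` need not span
-- `F`.
open LinearMap in
theorem LinearMap.charpoly_adjoint_comp_self_of_splitting {c : ℝ} (hc : c ≠ 0)
    {A : E₁ →ₗ[ℝ] E} {B : E₂ →ₗ[ℝ] E}
    {A' : F₁ →ₗ[ℝ] F} {B' : F₂ →ₗ[ℝ] F} {d : E →ₗ[ℝ] F} {d₁ : E₁ →ₗ[ℝ] F₁} {d₂ : E₂ →ₗ[ℝ] F₂}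
    (hA : ∀ x y, inner ℝ (A x) (A y) = c * inner ℝ x y)
    (hB : ∀ x y, inner ℝ (B x) (B y) = c * inner ℝ x y) (hAB : ∀ x y, inner ℝ (A x) (B y) = 0)
    (hA' : ∀ x y, inner ℝ (A' x) (A' y) = c * inner ℝ x y)
    (hB' : ∀ x y, inner ℝ (B' x) (B' y) = c * inner ℝ x y)
    (hAB' : ∀ x y, inner ℝ (A' x) (B' y) = 0)
    (hdA : ∀ x, d (A x) = A' (d₁ x)) (hdB : ∀ x, d (B x) = B' (d₂ x))
    (hsurj : ∀ z, ∃ x y, z = A x + B y) :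
    (adjoint d ∘ₗ d).charpoly = (adjoint d₁ ∘ₗ d₁).charpoly * (adjoint d₂ ∘ₗ d₂).charpoly := by
  have hinj : Function.Injective (A.coprod B) := by
    rw [← ker_eq_bot, ker_eq_bot']
    rintro ⟨x, y⟩ h
    rw [coprod_apply] at h
    have hx : c * inner ℝ x x = 0 := by
      rw [← hA, ← add_zero (inner ℝ (A x) (A x)), ← hAB x y, ← inner_add_right, h,
        inner_zero_right, hAB]
    have hy : c * inner ℝ y y = 0 := by
      rw [← hB, ← zero_add (inner ℝ (B y) (B y)), ← hAB x y, ← inner_add_left, h,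
        inner_zero_left, hAB]
    simp only [mul_eq_zero, hc, false_or, inner_self_eq_zero] at hx hy
    simp [hx, hy]
  have hs : Function.Surjective (A.coprod B) := fun z => by
    obtain ⟨x, y, rfl⟩ := hsurj z
    exact ⟨(x, y), by simp⟩
  let e := LinearEquiv.ofBijective (A.coprod B) ⟨hinj, hs⟩
  rw [← charpoly_prodMap, ← LinearEquiv.charpoly_conj e]
  congr 1
  ext z
  obtain ⟨⟨x, y⟩, rfl⟩ := e.surjective z
  have h1 := adjoint_comp_self_intertwine hA hAB hA' hAB' hdA hdB hsurj x
  have h2 := adjoint_comp_self_intertwine hB (fun x y => by rw [real_inner_comm, hAB]) hB'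
    (fun x y => by rw [real_inner_comm, hAB']) hdB hdA
    (fun z => by obtain ⟨x, y, h⟩ := hsurj z; exact ⟨y, x, by rw [h, add_comm]⟩) y
  rw [LinearEquiv.conj_apply_apply, LinearEquiv.symm_apply_apply]
  change (adjoint d ∘ₗ d) (A x + B y) =
    A ((adjoint d₁ ∘ₗ d₁) x) + B ((adjoint d₂ ∘ₗ d₂) y)
  rw [map_add, h1, h2]

theorem LinearMap.specMultiset_eq_add_of_charpoly_eq_mul {T : E →ₗ[ℝ] E} {T₁ : E₁ →ₗ[ℝ] E₁}
    {T₂ : E₂ →ₗ[ℝ] E₂} (h : T.charpoly = T₁.charpoly * T₂.charpoly) :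
    T.specMultiset = T₁.specMultiset + T₂.specMultiset := by
  rw [specMultiset, h, Polynomial.aroots_mul
    (mul_ne_zero T₁.charpoly_monic.ne_zero T₂.charpoly_monic.ne_zero)]
  rfl

end Splitting

/-! ### Ordered faces and cochains given by alternating functions -/

namespace AbstractSimplicialComplex

variable {V W : Type*} {K : AbstractSimplicialComplex V} {i : ℕ}

theorem OrderedFace.card_toFace (t : K.OrderedFace i) : t.toFace.1.card = i + 1 := by
  simp [toFace]

theorem OrderedFace.mem_toFace {t : K.OrderedFace i} {v : V} :
    v ∈ t.toFace.1 ↔ ∃ j, t.1 j = v := by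
  simp [toFace]

theorem OrderedFace.erase_incident (t : K.OrderedFace (i + 1)) (j : Fin (i + 2)) :
    (t.erase j).toFace.1.Incident t.toFace.1 := by
  refine ⟨fun v hv => ?_, by simp [card_toFace]⟩
  obtain ⟨k, rfl⟩ := mem_toFace.1 hv
  exact mem_toFace.2 ⟨j.succAbove k, rfl⟩

/-- The cochain with prescribed values on ordered faces. -/
def Cochain.ofAlternating (w : K.FaceWeight) (f : K.OrderedFace i → ℝ)
    (hf : ∀ t σ, f (t.perm σ) = ((Equiv.Perm.sign σ : ℤ) : ℝ) * f t) : K.Cochain w i :=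
  (K.orientationRelations i).liftQ (Finsupp.linearCombination ℝ f) (by
    rw [orientationRelations, Submodule.span_le]
    rintro _ ⟨t, σ, rfl⟩
    simp [hf])

@[simp]
theorem Cochain.eval_ofAlternating {w : K.FaceWeight} {f : K.OrderedFace i → ℝ} {hf}
    (t : K.OrderedFace i) : (ofAlternating w f hf).eval t = f t := by
  change (K.orientationRelations i).liftQ (Finsupp.linearCombination ℝ f) _ t.toChain = _
  rw [OrderedFace.toChain, Submodule.mkQ_apply, Submodule.liftQ_apply,
    Finsupp.linearCombination_single, one_smul]

@[simp]
theorem Cochain.eval_add {w : K.FaceWeight} (f g : K.Cochain w i) (t : K.OrderedFace i) :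
    (f + g).eval t = f.eval t + g.eval t := rfl

@[simp]
theorem Cochain.eval_smul {w : K.FaceWeight} (r : ℝ) (f : K.Cochain w i) (t : K.OrderedFace i) :
    (r • f).eval t = r * f.eval t := rfl

theorem IncidenceSign.one_apply {F F' : K} (h : F.1.Incident F'.1) :
    (one K).toFun F F' = 1 := by
  simp [one, h]

variable [DecidableEq W] {M : AbstractSimplicialComplex W}

/-! ### Lifting ordered faces and pulling back cochains along a covering -/

namespace SimplicialMap

variable {φ : SimplicialMap K M}

theorem IsCovering.injOn (h : φ.IsCovering) (F : K) : Set.InjOn φ.toFun F.1 :=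
  (h.bijOn _ F rfl).injOn

theorem IsCovering.card_mapFace (h : φ.IsCovering) (F : K) :
    (φ.mapFace F).1.card = F.1.card :=
  Finset.card_image_of_injOn (h.injOn F)

theorem IsCovering.mapFace_incident (h : φ.IsCovering) {F F' : K} (hF : F.1.Incident F'.1) :
    (φ.mapFace F).1.Incident (φ.mapFace F').1 :=
  ⟨Finset.image_subset_image hF.1, by rw [h.card_mapFace, h.card_mapFace, hF.2]⟩

/-- The ordered face `(φ v₀, …, φ v_i)`. -/
def mapOrderedFace (hφ : φ.IsCovering) (t : K.OrderedFace i) : M.OrderedFace i :=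
  ⟨⟨φ.toFun ∘ t.1, fun a b hab => t.1.injective (hφ.injOn t.toFace
      (OrderedFace.mem_toFace.2 ⟨a, rfl⟩) (OrderedFace.mem_toFace.2 ⟨b, rfl⟩) hab)⟩, by
    convert φ.image_mem _ t.2 using 1
    ext x
    simp only [Finset.mem_map, Finset.mem_image, Finset.mem_univ, true_and,
      exists_exists_eq_and]
    rfl⟩

theorem toFace_mapOrderedFace (hφ : φ.IsCovering) (t : K.OrderedFace i) :
    (mapOrderedFace hφ t).toFace = φ.mapFace t.toFace := by
  apply Subtype.ext
  ext x
  rw [OrderedFace.mem_toFace]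
  simp only [mapFace, Finset.mem_image, OrderedFace.mem_toFace, exists_exists_eq_and]
  rfl

theorem mapOrderedFace_perm (hφ : φ.IsCovering) (t : K.OrderedFace i)
    (σ : Equiv.Perm (Fin (i + 1))) :
    mapOrderedFace hφ (t.perm σ) = (mapOrderedFace hφ t).perm σ := rfl

theorem mapOrderedFace_erase (hφ : φ.IsCovering) (t : K.OrderedFace (i + 1)) (j : Fin (i + 2)) :
    mapOrderedFace hφ (t.erase j) = (mapOrderedFace hφ t).erase j := rfl

theorem eq_of_mapOrderedFace_eq (hφ : φ.IsCovering) {t t' : K.OrderedFace i}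
    (h : t.toFace = t'.toFace) (hm : mapOrderedFace hφ t = mapOrderedFace hφ t') : t = t' := by
  apply Subtype.ext
  ext j
  refine hφ.injOn t.toFace (OrderedFace.mem_toFace.2 ⟨j, rfl⟩)
    (h ▸ OrderedFace.mem_toFace.2 ⟨j, rfl⟩) ?_
  exact congrArg (fun u : M.OrderedFace i => u.1 j) hm

theorem exists_mapOrderedFace_eq (hφ : φ.IsCovering) (F : K) (u : M.OrderedFace i)
    (h : φ.mapFace F = u.toFace) : ∃ t : K.OrderedFace i, t.toFace = F ∧
      mapOrderedFace hφ t = u := by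
  have hex : ∀ j, ∃ v ∈ F.1, φ.toFun v = u.1 j := fun j =>
    (hφ.bijOn _ F h).surjOn (OrderedFace.mem_toFace.2 ⟨j, rfl⟩)
  choose v hv hvu using hex
  have hinj : Function.Injective v := fun a b hab => u.1.injective (by rw [← hvu, hab, hvu])
  have hmap : Finset.univ.map ⟨v, hinj⟩ = F.1 := by
    refine Finset.eq_of_subset_of_card_le (fun x hx => ?_) ?_
    · obtain ⟨j, -, rfl⟩ := Finset.mem_map.1 hx
      exact hv j
    · rw [← hφ.card_mapFace F, h, u.card_toFace]
      simp
  refine ⟨⟨⟨v, hinj⟩, hmap ▸ F.2⟩, Subtype.ext hmap, Subtype.ext ?_⟩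
  ext j
  exact hvu j

/-- The pullback of cochains along `φ`, multiplied by the function `ε` on the faces of `K`. -/
def twistedPullback (hφ : φ.IsCovering) (ε : K → ℝ) (wK : K.FaceWeight) (wM : M.FaceWeight)
    (i : ℕ) : M.Cochain wM i →ₗ[ℝ] K.Cochain wK i where
  toFun g := Cochain.ofAlternating wK (fun t => ε t.toFace * g.eval (mapOrderedFace hφ t))
    fun t σ => by
      rw [OrderedFace.toFace_perm, mapOrderedFace_perm, Cochain.eval_perm]
      ring
  map_add' f g := Cochain.ext_eval fun t => by simp [mul_add]
  map_smul' r f := Cochain.ext_eval fun t => by simp; ring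

variable {wK : K.FaceWeight} {wM : M.FaceWeight}

@[simp]
theorem eval_twistedPullback (hφ : φ.IsCovering) (ε : K → ℝ) (g : M.Cochain wM i)
    (t : K.OrderedFace i) :
    (twistedPullback hφ ε wK wM i g).eval t = ε t.toFace * g.eval (mapOrderedFace hφ t) := by
  simp only [twistedPullback, LinearMap.coe_mk, AddHom.coe_mk, Cochain.eval_ofAlternating]

/-- By `hε`, every facet term of `δ` carries the common factor `ε F'` and leaves behind exactly the
sign that `δ^s` prescribes on `M`. The case `ε = 1` with the trivial sign is the plain pullback. -/
theorem coboundary_twistedPullback [Finite V] [Finite W] (hφ : φ.IsCovering) (s : M.IncidenceSign)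
    {ε : K → ℝ}
    (hε : ∀ F F' : K, F.1.card = i + 1 → F.1.Incident F'.1 →
      ε F = ε F' * (s.toFun (φ.mapFace F) (φ.mapFace F') : ℝ)) (g : M.Cochain wM i) :
    K.coboundary wK i (twistedPullback hφ ε wK wM i g) =
      twistedPullback hφ ε wK wM (i + 1) (M.signedCoboundary wM s i g) := by
  refine Cochain.ext_eval fun t => ?_
  rw [coboundary_eval, eval_twistedPullback, signedCoboundary_eval, Finset.mul_sum]
  refine Finset.sum_congr rfl fun j _ => ?_
  rw [eval_twistedPullback, hε _ _ (t.erase j).card_toFace (t.erase_incident j),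
    ← mapOrderedFace_erase, toFace_mapOrderedFace, toFace_mapOrderedFace]
  ring

/-- A numbering by `Fin k` of the `i`-faces above each `i`-face of `M`. -/
def IsSheetEquiv (φ : SimplicialMap K M) {i k : ℕ} (e : M.Face i × Fin k ≃ K.Face i) : Prop :=
  ∀ G a, φ.mapFace (e (G, a)).1 = G.1

/-- Grouping the sum over `K` by fibres, the weight and the product of the values of `f` and `g`
depend only on `G`, so each fibre contributes the factor `c`. For two sheets, `c = 2` gives the
scaling and `c = 0` the orthogonality. -/
theorem inner_twistedPullback [Finite V] [Finite W] (hφ : φ.IsCovering)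
    (hw : ∀ F : K, wK.toFun F = wM.toFun (φ.mapFace F)) {k : ℕ}
    {e : M.Face i × Fin k ≃ K.Face i} (he : φ.IsSheetEquiv e) {ε ε' : K → ℝ} {c : ℝ}
    (hc : ∀ G, ∑ a, ε (e (G, a)).1 * ε' (e (G, a)).1 = c) (f g : M.Cochain wM i) :
    inner ℝ (twistedPullback hφ ε wK wM i f) (twistedPullback hφ ε' wK wM i g) =
      c * inner ℝ f g := by
  rw [Cochain.inner_eq, Cochain.inner_eq, ← Equiv.sum_comp e, Fintype.sum_prod_type,
    Finset.mul_sum]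
  refine Finset.sum_congr rfl fun G _ => ?_
  rw [← hc G, Finset.sum_mul]
  refine Finset.sum_congr rfl fun a _ => ?_
  have h := Cochain.eval_mul_eval f g (t := mapOrderedFace hφ (e (G, a)).orient) (t' := G.orient)
    (by rw [toFace_mapOrderedFace, Face.toFace_orient, Face.toFace_orient, he])
  rw [eval_twistedPullback, eval_twistedPullback, Face.toFace_orient, hw, he, ← h]
  ring

theorem exists_eq_add_twistedPullback (hφ : φ.IsCovering) {e : M.Face i × Fin 2 ≃ K.Face i}
    (he : φ.IsSheetEquiv e) {ε : K → ℝ} (hε : ∀ G a, ε (e (G, a)).1 = (-1) ^ (a : ℕ))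
    (y : K.Cochain wK i) :
    ∃ f g, y = twistedPullback hφ 1 wK wM i f + twistedPullback hφ ε wK wM i g := by
  -- `L a u` will be the lift of the ordered face `u` to sheet `a`.
  have hex : ∀ (a : Fin 2) (u : M.OrderedFace i), ∃ t : K.OrderedFace i,
      t.toFace = (e (⟨u.toFace, u.card_toFace⟩, a)).1 ∧ mapOrderedFace hφ t = u :=
    fun a u => exists_mapOrderedFace_eq hφ _ u (he _ a)
  choose L hL hLm using hex
  -- Lifts to a given face are unique, so lifting commutes with reordering; this makes the two
  -- cochains below alternating.
  have hperm : ∀ a u σ, L a (u.perm σ) = (L a u).perm σ := fun a u σ => by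
    refine eq_of_mapOrderedFace_eq hφ ?_ ?_
    · simp only [hL, OrderedFace.toFace_perm]
    · rw [hLm, mapOrderedFace_perm, hLm]
  -- The sheet-even and sheet-odd parts of `y`, with `ε = 1` on sheet 0 and `ε = -1` on sheet 1.
  refine ⟨Cochain.ofAlternating wM (fun u => (y.eval (L 0 u) + y.eval (L 1 u)) / 2) ?_,
    Cochain.ofAlternating wM (fun u => (y.eval (L 0 u) - y.eval (L 1 u)) / 2) ?_,
    Cochain.ext_eval fun t => ?_⟩
  · intro u σ
    simp only [hperm, Cochain.eval_perm]
    ring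
  · intro u σ
    simp only [hperm, Cochain.eval_perm]
    ring
  obtain ⟨⟨G, a⟩, ha⟩ := e.surjective ⟨t.toFace, t.card_toFace⟩
  have hG : φ.mapFace t.toFace = G.1 := by rw [← he G a, ha]
  have ht : L a (mapOrderedFace hφ t) = t := by
    refine eq_of_mapOrderedFace_eq hφ ?_ (hLm _ _)
    rw [hL]
    have : (⟨(mapOrderedFace hφ t).toFace, (mapOrderedFace hφ t).card_toFace⟩ : M.Face i) = G :=
      Subtype.ext ((toFace_mapOrderedFace hφ t).trans hG)
    rw [this, ha]
  have hεt : ε t.toFace = (-1) ^ (a : ℕ) := by rw [← hε G a, ha]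
  rw [Cochain.eval_add, eval_twistedPullback, eval_twistedPullback, hεt,
    Cochain.eval_ofAlternating, Cochain.eval_ofAlternating, Pi.one_apply]
  obtain rfl | rfl : a = 0 ∨ a = 1 := by omega
  all_goals
    rw [ht]
    norm_num
    try ring

theorem specMultiset_upLaplacian [Finite V] [Finite W] (hφ : φ.IsCovering)
    (hw : ∀ F : K, wK.toFun F = wM.toFun (φ.mapFace F)) {e : M.Face i × Fin 2 ≃ K.Face i}
    {e' : M.Face (i + 1) × Fin 2 ≃ K.Face (i + 1)} (he : φ.IsSheetEquiv e)
    (he' : φ.IsSheetEquiv e') (s : M.IncidenceSign) {ε : K → ℝ}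
    (hε : ∀ G a, ε (e (G, a)).1 = (-1) ^ (a : ℕ)) (hε' : ∀ G a, ε (e' (G, a)).1 = (-1) ^ (a : ℕ))
    (hs : ∀ F F' : K, F.1.card = i + 1 → F.1.Incident F'.1 →
      ε F = ε F' * (s.toFun (φ.mapFace F) (φ.mapFace F') : ℝ)) :
    (K.upLaplacian wK i).specMultiset =
      (M.upLaplacian wM i).specMultiset + (M.signedUpLaplacian wM s i).specMultiset := by
  refine LinearMap.specMultiset_eq_add_of_charpoly_eq_mul ?_
  refine LinearMap.charpoly_adjoint_comp_self_of_splitting two_ne_zero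
    (A := twistedPullback hφ 1 wK wM i) (B := twistedPullback hφ ε wK wM i)
    (A' := twistedPullback hφ 1 wK wM (i + 1)) (B' := twistedPullback hφ ε wK wM (i + 1))
    (inner_twistedPullback hφ hw he ?_) (inner_twistedPullback hφ hw he ?_) (fun x y => ?_)
    (inner_twistedPullback hφ hw he' ?_) (inner_twistedPullback hφ hw he' ?_) (fun x y => ?_)
    -- By definition, the signed coboundary for the all-ones sign is the ordinary one.
    (coboundary_twistedPullback hφ (IncidenceSign.one M) fun F F' _ h => ?_)
    (coboundary_twistedPullback hφ s hs)
    (exists_eq_add_twistedPullback hφ he hε)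
  · simp
  · simp [Fin.sum_univ_two, hε, one_add_one_eq_two]
  · rw [inner_twistedPullback hφ hw he (c := 0) (by simp [Fin.sum_univ_two, hε]), zero_mul]
  · simp
  · simp [Fin.sum_univ_two, hε', one_add_one_eq_two]
  · rw [inner_twistedPullback hφ hw he' (c := 0) (by simp [Fin.sum_univ_two, hε']), zero_mul]
  · simp [IncidenceSign.one_apply (hφ.mapFace_incident h)]

end SimplicialMap

end AbstractSimplicialComplex

/-! ### Signs and sheet numberings from permutation voltages -/

namespace AbstractSimplicialComplex

variable {V W : Type*} {K : AbstractSimplicialComplex V} {M : AbstractSimplicialComplex W} {i k : ℕ}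

open Classical in
theorem IncidenceSign.exists_isSignOf (ψ : (M.incidenceGraph i).PermVoltage k) :
    ∃ s : M.IncidenceSign, s.IsSignOf ψ := by
  refine ⟨⟨fun F F' =>
    if h : F.1.Incident F'.1 then
      if hF : F.1.card = i + 1 then
        SignType.sign (Equiv.Perm.sign (ψ.toFun ⟨(⟨F, Or.inl hF⟩, ⟨F', Or.inr (by rw [h.2, hF])⟩),
          Or.inl h⟩) : ℤ)
      -- `IsSignOf` only constrains incidences between dimensions `i` and `i + 1`; on the others any
      -- nonzero value would do.
      else 1
    else 0, fun F F' => ?_⟩, fun e he => ?_⟩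
  · split_ifs with h hF <;> simp [h]
  · have hF : e.fst.1.1.card = i + 1 := by
      rcases e.fst.2 with h | h
      · exact h
      · have h1 := he.2
        have h2 := e.snd.2
        omega
    simp only [dif_pos he, dif_pos hF]
    change ((SignType.sign (Equiv.Perm.sign (ψ.toFun e) : ℤ) : SignType) : ℤ) = _
    rcases Int.units_eq_one_or (Equiv.Perm.sign (ψ.toFun e)) with h | h <;> simp [h]

theorem nonempty_coe (F : K) : F.1.Nonempty := by
  rw [Finset.nonempty_iff_ne_empty]
  intro h
  exact (K.isRelLowerSet_faces F.2).1.ne_empty h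

variable [DecidableEq W]

namespace SimplicialMap

variable {φ : SimplicialMap K M}

/-! ### The spectrum from a derived graph description -/

/-- A covering preserves the cardinality of faces, so `η` restricts to each of the two dimensions `j
= i` and `j = i + 1`. -/
theorem exists_isSheetEquiv (hφ : φ.IsCovering)
    (η : M.IncidenceVertex i × Fin k ≃ K.IncidenceVertex i)
    (hη : ∀ G a, φ.mapFace (η (G, a)).1 = G.1) {j : ℕ}
    (hj : ∀ n, n = j + 1 → n = i + 1 ∨ n = i + 2) :
    ∃ e : M.Face j × Fin k ≃ K.Face j, φ.IsSheetEquiv e ∧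
      ∀ G a, (e (G, a)).1 = (η (⟨G.1, hj _ G.2⟩, a)).1 := by
  let f : M.Face j × Fin k → K.Face j := fun p =>
    ⟨(η (⟨p.1.1, hj _ p.1.2⟩, p.2)).1, by rw [← hφ.card_mapFace, hη]; exact p.1.2⟩
  have hf : Function.Bijective f := by
    constructor
    · rintro ⟨G, a⟩ ⟨G', a'⟩ h
      have h0 : (η (⟨G.1, hj _ G.2⟩, a)).1 = (η (⟨G'.1, hj _ G'.2⟩, a')).1 :=
        congrArg (fun F : K.Face j => F.1) h
      have h1 := η.injective (Subtype.ext h0)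
      rw [Prod.mk.injEq] at h1
      exact Prod.ext (Subtype.ext (congrArg (fun F : M.IncidenceVertex i => F.1) h1.1)) h1.2
    · intro F
      obtain ⟨⟨G, a⟩, h⟩ := η.surjective ⟨F.1, hj _ F.2⟩
      have hG : φ.mapFace F.1 = G.1 := by rw [← hη G a, h]
      refine ⟨(⟨G.1, by rw [← hG, hφ.card_mapFace]; exact F.2⟩, a), Subtype.ext ?_⟩
      exact congrArg (fun F : K.IncidenceVertex i => F.1) h
  exact ⟨Equiv.ofBijective f hf, fun G a => hη _ a, fun G a => rfl⟩

/-- This is where two sheets are essential: a permutation of two letters acts on the sheet signs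
`±1` as multiplication by its sign. -/
theorem sign_mul_neg_one_pow (σ : Equiv.Perm (Fin 2)) (b : Fin 2) :
    (-1 : ℤ) ^ (σ b : ℕ) = (Equiv.Perm.sign σ : ℤ) * (-1) ^ (b : ℕ) := by
  revert σ b
  decide

theorem specMultiset_upLaplacian_of_isDerivedBy [Finite V] [Finite W] (hφ : φ.IsCovering)
    {wK : K.FaceWeight} {wM : M.FaceWeight}
    (hw : ∀ F : K, wK.toFun F = wM.toFun (φ.mapFace F))
    {ψ : (M.incidenceGraph i).PermVoltage 2} {s : M.IncidenceSign}
    (hψ : φ.IsDerivedBy ψ) (hs : s.IsSignOf ψ) :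
    (K.upLaplacian wK i).specMultiset =
      (M.upLaplacian wM i).specMultiset + (M.signedUpLaplacian wM s i).specMultiset := by
  classical
  obtain ⟨η, hη⟩ := hψ
  obtain ⟨e, he, heη⟩ := exists_isSheetEquiv hφ η.toEquiv hη (j := i) fun n h => Or.inl h
  obtain ⟨e', he', heη'⟩ := exists_isSheetEquiv hφ η.toEquiv hη (j := i + 1) fun n h => Or.inr h
  -- The sheet sign read off from `η`; the value 1 in other dimensions plays no role.
  let ε : K → ℝ := fun F =>
    if h : F.1.card = i + 1 ∨ F.1.card = i + 2 then (-1) ^ ((η.symm ⟨F, h⟩).2 : ℕ) else 1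
  have hε : ∀ G a, ε (η (G, a)).1 = (-1) ^ (a : ℕ) := fun G a => by
    simp only [ε, dif_pos (η (G, a)).2, Subtype.coe_eta, RelIso.symm_apply_apply]
  refine specMultiset_upLaplacian hφ hw he he' s (ε := ε) (fun G a => ?_) (fun G a => ?_)
    fun F F' hF hFF' => ?_
  · rw [heη]; exact hε _ a
  · rw [heη']; exact hε _ a
  obtain ⟨⟨G, a⟩, hG⟩ := η.surjective ⟨F, Or.inl hF⟩
  obtain ⟨⟨G', a'⟩, hG'⟩ := η.surjective ⟨F', Or.inr (by rw [hFF'.2, hF])⟩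
  -- The incidence in `K` becomes an edge of the derived graph, which forces `a = ψ(G, G')(a')`.
  have hadj : ψ.derivedGraph.Adj (G, a) (G', a') := by
    rw [← η.map_adj_iff, hG, hG']
    exact Or.inl hFF'
  obtain ⟨h, ha⟩ := hadj
  have hFη : F = (η (G, a)).1 := by rw [hG]
  have hFη' : F' = (η (G', a')).1 := by rw [hG']
  have hinc : G.1.1.Incident G'.1.1 := by
    rw [← hη G a, ← hη G' a', ← hFη, ← hFη']
    exact hφ.mapFace_incident hFF'
  have hsign := hs ⟨(G, G'), h⟩ hinc
  have hpow := sign_mul_neg_one_pow (ψ.toFun ⟨(G, G'), h⟩) a'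
  dsimp only at ha hsign
  rw [← ha, ← hsign] at hpow
  have hpow' := congrArg (Int.cast : ℤ → ℝ) hpow
  push_cast at hpow'
  rw [hFη, hFη', hε, hε, hη, hη, hpow', mul_comm]

/-! ### Existence of the permutation voltages -/

/-- The fibres are numbered independently of each other; `ψ` will absorb any mismatch between
neighbouring numberings. -/
theorem exists_incidenceVertex_equiv (hφ : φ.IsFoldCovering k) (i : ℕ) [NeZero k] :
    ∃ η : M.IncidenceVertex i × Fin k ≃ K.IncidenceVertex i,
      ∀ G a, φ.mapFace (η (G, a)).1 = G.1 := by
  have hfin : ∀ G : M, Nonempty (Fin k ≃ {F : K // φ.mapFace F = G}) := fun G => by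
    have h := hφ.card_fiber G
    have : Finite {F : K // φ.mapFace F = G} :=
      Nat.finite_of_card_ne_zero (by rw [h]; exact NeZero.ne k)
    exact ⟨(Finite.equivFinOfCardEq h).symm⟩
  let q := fun G => (hfin G).some
  let f : M.IncidenceVertex i × Fin k → K.IncidenceVertex i := fun p =>
    ⟨(q p.1.1 p.2).1, by
      rw [← hφ.card_mapFace, (q p.1.1 p.2).2]
      exact p.1.2⟩
  have hf : Function.Bijective f := by
    constructor
    · rintro ⟨G, a⟩ ⟨G', a'⟩ h
      have h1 : (q G.1 a).1 = (q G'.1 a').1 := congrArg Subtype.val h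
      obtain rfl : G = G' := Subtype.ext (by rw [← (q G.1 a).2, h1, (q G'.1 a').2])
      rw [(q G.1).injective (Subtype.ext h1)]
    · intro F
      refine ⟨(⟨φ.mapFace F.1, by rw [hφ.card_mapFace]; exact F.2⟩,
        (q (φ.mapFace F.1)).symm ⟨F.1, rfl⟩), Subtype.ext ?_⟩
      simp [f]
  exact ⟨Equiv.ofBijective f hf, fun G a => (q G.1 a).2⟩

theorem IsCovering.eq_of_mapFace_eq (hφ : φ.IsCovering) {F F' : K}
    (h : φ.mapFace F = φ.mapFace F') {v : V} (hv : v ∈ F.1) (hv' : v ∈ F'.1) : F = F' := by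
  by_contra hne
  exact Finset.disjoint_left.1 (hφ.disjoint _ F F' h rfl hne) hv hv'

/-- Downward lifting needs no strength assumption: keep the vertices of `F'` that map into `G`. -/
theorem IsCovering.exists_incident_of_mapFace (hφ : φ.IsCovering) {G : M} {F' : K}
    (h : G.1.Incident (φ.mapFace F').1) : ∃ F : K, F.1.Incident F'.1 ∧ φ.mapFace F = G := by
  classical
  have himg : (F'.1.filter (φ.toFun · ∈ G.1)).image φ.toFun = G.1 := by
    ext x
    simp only [Finset.mem_image, Finset.mem_filter]
    constructor
    · rintro ⟨v, ⟨-, hv⟩, rfl⟩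
      exact hv
    · intro hx
      obtain ⟨v, hv, rfl⟩ := Finset.mem_image.1 (h.1 hx)
      exact ⟨v, ⟨hv, hx⟩, rfl⟩
  have hne : (F'.1.filter (φ.toFun · ∈ G.1)).Nonempty := by
    rw [← Finset.image_nonempty (f := φ.toFun), himg]
    exact nonempty_coe G
  let F : K := ⟨_, (K.isRelLowerSet_faces F'.2).2 (Finset.filter_subset _ _) hne⟩
  have hF : φ.mapFace F = G := Subtype.ext himg
  exact ⟨F, ⟨Finset.filter_subset _ _, by
    rw [← hφ.card_mapFace F, ← hφ.card_mapFace F', hF, h.2]⟩, hF⟩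

/-- Upward neighbours exist by the strong lifting property, downward ones by restriction. Two upward
neighbours over `G'` both contain `F`, so disjointness of the fibre makes them equal; two downward
ones lie inside `F`, where `φ` is injective. The mixed cases fail by cardinality. -/
theorem IsStrongCovering.existsUnique_adj (hφ : φ.IsStrongCovering) {G G' : M.IncidenceVertex i}
    (h : (M.incidenceGraph i).Adj G G') (F : K.IncidenceVertex i) (hF : φ.mapFace F.1 = G.1) :
    ∃! F' : K.IncidenceVertex i, (K.incidenceGraph i).Adj F F' ∧ φ.mapFace F'.1 = G'.1 := by
  have hcard : ∀ {E E' : K}, φ.mapFace E = φ.mapFace E' → E.1.card = E'.1.card :=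
    fun hE => by rw [← hφ.card_mapFace, hE, hφ.card_mapFace]
  have hex : ∃ F' : K, (F.1.1.Incident F'.1 ∨ F'.1.Incident F.1.1) ∧ φ.mapFace F' = G'.1 := by
    rcases h with h | h
    · obtain ⟨F', h1, h2⟩ := hφ.lift _ _ h F.1 hF
      exact ⟨F', Or.inl h1, h2⟩
    · rw [← hF] at h
      obtain ⟨F', h1, h2⟩ := hφ.exists_incident_of_mapFace h
      exact ⟨F', Or.inr h1, h2⟩
  obtain ⟨F', h1, h2⟩ := hex
  refine ⟨⟨F', by rw [← hφ.card_mapFace, h2]; exact G'.2⟩, ⟨h1, h2⟩, ?_⟩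
  rintro ⟨E, hE⟩ ⟨hadj, hEG⟩
  apply Subtype.ext
  have hEF : φ.mapFace E = φ.mapFace F' := hEG.trans h2.symm
  change F.1.1.Incident E.1 ∨ E.1.Incident F.1.1 at hadj
  have hc := hcard hEF
  rcases h1 with h1 | h1 <;> rcases hadj with hadj | hadj
  · obtain ⟨v, hv⟩ := nonempty_coe F.1
    exact hφ.eq_of_mapFace_eq hEF (hadj.1 hv) (h1.1 hv)
  · exact absurd hadj.2 (by have := h1.2; omega)
  · exact absurd hadj.2 (by have := h1.2; omega)
  · refine Subtype.ext (Finset.Subset.antisymm ?_ ?_) <;> intro v hv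
    · obtain ⟨u, hu, huv⟩ := Finset.mem_image.1
        ((congrArg Subtype.val hEF) ▸ Finset.mem_image_of_mem φ.toFun hv :
          φ.toFun v ∈ (φ.mapFace F').1)
      rwa [← hφ.injOn F.1 (h1.1 hu) (hadj.1 hv) huv]
    · obtain ⟨u, hu, huv⟩ := Finset.mem_image.1
        ((congrArg Subtype.val hEF.symm) ▸ Finset.mem_image_of_mem φ.toFun hv :
          φ.toFun v ∈ (φ.mapFace E).1)
      rwa [← hφ.injOn F.1 (hadj.1 hu) (h1.1 hv) huv]

theorem IsFoldCovering.exists_isDerivedBy [NeZero k] (hφ : φ.IsFoldCovering k) (i : ℕ) :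
    ∃ ψ : (M.incidenceGraph i).PermVoltage k, φ.IsDerivedBy ψ := by
  obtain ⟨η, hη⟩ := exists_incidenceVertex_equiv hφ i
  have hadj : ∀ {p q}, (K.incidenceGraph i).Adj (η p) (η q) → (M.incidenceGraph i).Adj p.1 q.1 := by
    rintro ⟨G, a⟩ ⟨G', a'⟩ h
    change (G.1.1.Incident G'.1.1 ∨ G'.1.1.Incident G.1.1)
    rw [← hη G a, ← hη G' a']
    exact h.imp hφ.mapFace_incident hφ.mapFace_incident
  -- Unique neighbours define `ψ(d)(b)`: the sheet over `d.fst` whose face is adjacent to face `b`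
  -- over `d.snd`.
  have hex : ∀ (d : (M.incidenceGraph i).Dart) (b : Fin k),
      ∃ a, ∀ a', (K.incidenceGraph i).Adj (η (d.fst, a')) (η (d.snd, b)) ↔ a' = a := by
    intro d b
    obtain ⟨F, ⟨hF1, hF2⟩, hF3⟩ := hφ.existsUnique_adj d.adj.symm (η (d.snd, b)) (hη _ _)
    obtain ⟨⟨G, a⟩, rfl⟩ := η.surjective F
    obtain rfl : G = d.fst := Subtype.ext (by rw [← hη, hF2])
    refine ⟨a, fun a' => ⟨fun h => ?_, ?_⟩⟩
    · exact (Prod.ext_iff.1 (η.injective (hF3 _ ⟨h.symm, hη _ _⟩))).2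
    · rintro rfl
      exact hF1.symm
  choose f hf using hex
  -- Adjacency is symmetric, so the reversed dart gives the inverse matching; hence `f d` is a
  -- permutation and `map_symm` holds.
  have hinv : ∀ d b, f d.symm (f d b) = b := fun d b =>
    ((hf d.symm (f d b) b).1 ((hf d b (f d b)).2 rfl).symm).symm
  let ψ : (M.incidenceGraph i).PermVoltage k :=
    { toFun := fun d => ⟨f d, f d.symm, hinv d, fun b => by
        simpa only [SimpleGraph.Dart.symm_symm] using hinv d.symm b⟩
      map_symm := fun d => Equiv.ext fun b => rfl }
  refine ⟨ψ, ⟨η, ?_⟩, hη⟩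
  rintro ⟨G, a⟩ ⟨G', b⟩
  constructor
  · intro h
    exact ⟨hadj h, (hf ⟨(G, G'), hadj h⟩ b a).1 h⟩
  · rintro ⟨h, hab⟩
    exact (hf ⟨(G, G'), h⟩ b a).2 hab

end SimplicialMap

end AbstractSimplicialComplex

end

theorem theorem1p5 {V W : Type*} [Fintype V] [Fintype W] [DecidableEq W]
    (K : AbstractSimplicialComplex V) (M : AbstractSimplicialComplex W)
    (φ : AbstractSimplicialComplex.SimplicialMap K M) (hφ : φ.IsFoldCovering 2)
    (wK : K.FaceWeight) (wM : M.FaceWeight)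
    (hw : ∀ F : K, wK.toFun F = wM.toFun (φ.mapFace F)) (i : ℕ) :
    (∃ (ψ : (M.incidenceGraph i).PermVoltage 2) (s : M.IncidenceSign),
      φ.IsDerivedBy ψ ∧ s.IsSignOf ψ) ∧
    ∀ (ψ : (M.incidenceGraph i).PermVoltage 2) (s : M.IncidenceSign),
      φ.IsDerivedBy ψ → s.IsSignOf ψ →
        (K.upLaplacian wK i).specMultiset =
          (M.upLaplacian wM i).specMultiset + (M.signedUpLaplacian wM s i).specMultiset := by
  refine ⟨?_, fun ψ s hψ hs => ?_⟩
  · obtain ⟨ψ, hψ⟩ := hφ.exists_isDerivedBy i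
    obtain ⟨s, hs⟩ := AbstractSimplicialComplex.IncidenceSign.exists_isSignOf ψ
    exact ⟨ψ, s, hψ, hs⟩
  · exact AbstractSimplicialComplex.SimplicialMap.specMultiset_upLaplacian_of_isDerivedBy
      hφ.toIsCovering hw hψ hs
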